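/- Let $(X,d_X)$ and $(Y,d_Y)$ be uniformly locally finite metric spaces, i.e. for every $r>0$ the cardinalities of the closed balls of radius $r$ are uniformly bounded. For a bounded operator $a$ on $\ell_2(X)$ with matrix entries $a_{xy}=\langle a\delta_y,\delta_x\rangle$, say that $a$ has finite propagation if $\sup\{d_X(x,y) : a_{xy}\neq 0\}<\infty$, and let the uniform Roe algebra $\mathrm{C}^*_u(X)$ be the operator-norm closure in $\mathcal{B}(\ell_2(X))$ of the $*$-algebra of bounded operators of finite propagation. Call $a$ a ghost if $\lim_{x,y\to\infty}a_{xy}=0$, i.e. for every $\varepsilon>0$ there is a finite set $F\subseteq X$ such that $|a_{xy}|<\varepsilon$ for all $x,y\in X\setminus F$; define the same notions for $Y$. If $\Phi\colon \mathrm{C}^*_u(X)\to \mathrm{C}^*_u(Y)$ is a $*$-isomorphism, then for every $a\in\mathrm{C}^*_u(X)$, the operator $a$ is a ghost if and only if $\Phi(a)$ is a ghost. -/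

import Mathlib

open Filter Topology

/-- A metric space is uniformly locally finite (has bounded geometry) if for every `r > 0` the
cardinalities of its closed balls of radius `r` are bounded by one natural number. -/
def UniformlyLocallyFinite (X : Type*) [MetricSpace X] : Prop :=
  ∀ r : ℝ, 0 < r → ∃ N : ℕ, ∀ x : X, (Metric.closedBall x r).encard ≤ N

/-- The complex Hilbert space `ℓ₂(X)`. -/
abbrev EllTwo (X : Type*) : Type _ := lp (fun _ : X => ℂ) 2

/-- The algebra of bounded operators on `ℓ₂(X)`. -/
abbrev BoundedOp (X : Type*) : Type _ := EllTwo X →L[ℂ] EllTwo X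

open Classical in
/-- The vector `δ_x` of the canonical orthonormal basis of `ℓ₂(X)`. -/
noncomputable def deltaVec {X : Type*} (x : X) : EllTwo X := lp.single 2 x (1 : ℂ)

/-- The matrix entry `a_{xy}`, the `x`-th coordinate of `a δ_y`. -/
noncomputable def matEntry {X : Type*} (a : BoundedOp X) (x y : X) : ℂ := a (deltaVec y) x

theorem inner_deltaVec {X : Type*} (x : X) (v : EllTwo X) : inner ℂ (deltaVec x) v = v x := by
  classical
  have h := lp.inner_single_left (𝕜 := ℂ) x (1 : ℂ) v
  simp only [RCLike.inner_apply, map_one, mul_one] at h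
  rw [← h]
  unfold deltaVec
  congr!

theorem matEntry_eq_inner {X : Type*} (a : BoundedOp X) (x y : X) :
    matEntry a x y = inner ℂ (deltaVec x) (a (deltaVec y)) :=
  (inner_deltaVec x _).symm

theorem deltaVec_self {X : Type*} (x : X) : (deltaVec x : EllTwo X) x = 1 := by
  simp [deltaVec]

theorem deltaVec_ne {X : Type*} {x y : X} (h : y ≠ x) : (deltaVec x : EllTwo X) y = 0 := by
  simp [deltaVec, h]

theorem matEntry_star {X : Type*} (a : BoundedOp X) (x y : X) :
    matEntry (star a) x y = starRingEnd ℂ (matEntry a y x) := by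
  rw [matEntry_eq_inner, matEntry_eq_inner, ContinuousLinearMap.star_eq_adjoint,
    ContinuousLinearMap.adjoint_inner_right, inner_conj_symm]

theorem single_eq_smul_deltaVec {X : Type*} [DecidableEq X] (x : X) (c : ℂ) :
    (lp.single 2 x c : EllTwo X) = c • deltaVec x := by
  ext z
  by_cases h : z = x
  · subst h; simp [deltaVec]
  · simp [deltaVec, h]

theorem hasSum_matEntry_mul {X : Type*} (a b : BoundedOp X) (x y : X) :
    HasSum (fun z => matEntry a x z * matEntry b z y) (matEntry (a * b) x y) := by
  classical
  have h := lp.hasSum_single (p := 2) (by norm_num) (b (deltaVec y))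
  have h2 := ((innerSL ℂ (deltaVec x : EllTwo X)).comp a).hasSum h
  have h3 : (fun z => matEntry a x z * matEntry b z y) =
      fun z => ((innerSL ℂ (deltaVec x : EllTwo X)).comp a) (lp.single 2 z (b (deltaVec y) z)) := by
    funext z
    simp [single_eq_smul_deltaVec, matEntry, inner_deltaVec, mul_comm]
  rw [h3, matEntry_eq_inner]
  exact h2

/-- The operator `a` has finite propagation: the distances `d(x, y)` over all pairs with
`a_{xy} ≠ 0` are bounded, i.e. `sup {d(x, y) | a_{xy} ≠ 0} < ∞`. -/
def HasFinitePropagation {X : Type*} [MetricSpace X] (a : BoundedOp X) : Prop :=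
  ∃ r : ℝ, ∀ x y : X, matEntry a x y ≠ 0 → dist x y ≤ r

theorem HasFinitePropagation.mul {X : Type*} [MetricSpace X] {a b : BoundedOp X}
    (ha : HasFinitePropagation a) (hb : HasFinitePropagation b) :
    HasFinitePropagation (a * b) := by
  obtain ⟨r, hr⟩ := ha
  obtain ⟨s, hs⟩ := hb
  refine ⟨r + s, fun x y hxy => ?_⟩
  by_contra hd
  refine hxy ((hasSum_matEntry_mul a b x y).unique ?_)
  convert hasSum_zero with z
  by_contra hz
  have h1 := hr x z (left_ne_zero_of_mul hz)
  have h2 := hs z y (right_ne_zero_of_mul hz)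
  exact hd ((dist_triangle x z y).trans (add_le_add h1 h2))

theorem HasFinitePropagation.add {X : Type*} [MetricSpace X] {a b : BoundedOp X}
    (ha : HasFinitePropagation a) (hb : HasFinitePropagation b) :
    HasFinitePropagation (a + b) := by
  obtain ⟨r, hr⟩ := ha
  obtain ⟨s, hs⟩ := hb
  refine ⟨max r s, fun x y hxy => ?_⟩
  have hadd : matEntry (a + b) x y = matEntry a x y + matEntry b x y := by simp [matEntry]
  by_cases h : matEntry a x y = 0
  · exact (hs x y (fun h' => hxy (by rw [hadd, h, h', add_zero]))).trans (le_max_right _ _)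
  · exact (hr x y h).trans (le_max_left _ _)

theorem HasFinitePropagation.star {X : Type*} [MetricSpace X] {a : BoundedOp X}
    (ha : HasFinitePropagation a) : HasFinitePropagation (star a) := by
  obtain ⟨r, hr⟩ := ha
  refine ⟨r, fun x y hxy => ?_⟩
  rw [dist_comm]
  refine hr y x fun h => hxy ?_
  rw [matEntry_star, h, map_zero]

theorem HasFinitePropagation.algebraMap {X : Type*} [MetricSpace X] (c : ℂ) :
    HasFinitePropagation (algebraMap ℂ (BoundedOp X) c) := by
  refine ⟨0, fun x y hxy => ?_⟩
  by_contra hd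
  have hne : x ≠ y := fun h => hd (by rw [h, dist_self])
  refine hxy ?_
  simp [matEntry, Algebra.algebraMap_eq_smul_one, deltaVec_ne hne]

/-- The `*`-algebra of bounded operators of finite propagation on `ℓ₂(X)`. -/
noncomputable def finitePropagationAlgebra (X : Type*) [MetricSpace X] :
    StarSubalgebra ℂ (BoundedOp X) where
  carrier := {a | HasFinitePropagation a}
  mul_mem' := HasFinitePropagation.mul
  add_mem' := HasFinitePropagation.add
  algebraMap_mem' := HasFinitePropagation.algebraMap
  star_mem' := HasFinitePropagation.star

/-- The uniform Roe algebra `C*ᵤ(X)`: the operator-norm closure, in the bounded operators on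
`ℓ₂(X)`, of the `*`-algebra of operators of finite propagation. -/
noncomputable def uniformRoeAlgebra (X : Type*) [MetricSpace X] :
    StarSubalgebra ℂ (BoundedOp X) :=
  (finitePropagationAlgebra X).topologicalClosure

/-- The operator `a = [a_{xy}]` is a ghost: `a_{xy} → 0` as `x, y → ∞`, where "`x → ∞`" means that
`x` leaves every finite subset of `X`. -/
def IsGhost {X : Type*} (a : BoundedOp X) : Prop :=
  Tendsto (fun p : X × X => matEntry a p.1 p.2) (cofinite ×ˢ cofinite) (𝓝 0)

/-! Each `Φ (matUnit x x)` is a minimal projection, hence has rank one with a unit range vector `ξ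
x`; these vectors form an orthonormal basis of `ℓ₂(Y)`, and the entries of `a` have the moduli of
the entries of `Φ a` in that basis (`norm_matEntry`). It remains to localize `ξ x`: to show that it
lies, up to a small error, in a ball of uniform radius about some point `g x`. The images of
diagonal sign operators have columns decaying at a common rate, by Baire category on `X → Bool`
(`exists_columnDecay_signOp`); hence so do the rank-one projections onto the `ξ x`. If all
coefficients of some `deltaVec y` in the basis were tiny, a good choice of signs would make the
unitary image of a sign operator carry `deltaVec y` mostly out of a ball where it must stay
(`exists_le_norm_apply`). Applied to `Φ.symm`, whose frame has the transposed moduli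
(`norm_apply_eq_symm`), this gives a point `g x` with `‖ξ x (g x)‖ ≥ δ`, and the decay of the
projection then concentrates `ξ x` near `g x`. Thus an entry of `a` is nearly a combination of
boundedly many entries of `Φ a` near `(g x, g x')`, and those balls leave any finite set as `x` and
`x'` do. -/

open InnerProductSpace

/-! ### Diagonal and rank-one operators -/

/-- Multiplication on `ℓ₂(X)` by a function bounded by `1`. -/
noncomputable def diagOp {X : Type*} (s : X → ℂ) (hs : ∀ x, ‖s x‖ ≤ 1) : BoundedOp X :=
  have hle (v : EllTwo X) (x : X) : ‖s x * v x‖ ≤ ‖v x‖ := by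
    rw [norm_mul]
    exact mul_le_of_le_one_left (norm_nonneg _) (hs x)
  have hmem (v : EllTwo X) : Memℓp (fun x => s x * v x) 2 := by
    have h2 : (0 : ℝ) < (2 : ENNReal).toReal := by norm_num
    refine memℓp_gen (((lp.memℓp v).summable h2).of_nonneg_of_le (fun x => by positivity)
      fun x => ?_)
    exact Real.rpow_le_rpow (norm_nonneg _) (hle v x) h2.le
  LinearMap.mkContinuous
    { toFun := fun v => ⟨fun x => s x * v x, hmem v⟩
      map_add' := fun v w => by ext x; exact mul_add _ _ _
      map_smul' := fun c v => by ext x; simp [mul_left_comm] } 1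
    fun v => by
      rw [one_mul]
      exact lp.norm_mono (p := 2) (by norm_num) (hle v)

@[simp] theorem diagOp_apply {X : Type*} (s : X → ℂ) (hs : ∀ x, ‖s x‖ ≤ 1) (v : EllTwo X) (x : X) :
    diagOp s hs v x = s x * v x := rfl

theorem norm_diagOp_apply_le {X : Type*} (s : X → ℂ) (hs : ∀ x, ‖s x‖ ≤ 1) (v : EllTwo X) :
    ‖diagOp s hs v‖ ≤ ‖v‖ := by
  refine lp.norm_mono (p := 2) (by norm_num) fun x => ?_
  rw [diagOp_apply, norm_mul]
  exact mul_le_of_le_one_left (norm_nonneg _) (hs x)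

theorem norm_deltaVec {X : Type*} (x : X) : ‖(deltaVec x : EllTwo X)‖ = 1 := by
  have h : inner ℂ (deltaVec x : EllTwo X) (deltaVec x) = (1 : ℂ) := by
    rw [inner_deltaVec, deltaVec_self]
  rw [norm_eq_sqrt_re_inner (𝕜 := ℂ), h]
  simp

theorem diagOp_deltaVec {X : Type*} (s : X → ℂ) (hs : ∀ x, ‖s x‖ ≤ 1) (x : X) :
    diagOp s hs (deltaVec x) = s x • deltaVec x := by
  ext z
  by_cases h : z = x
  · subst h; simp
  · simp [deltaVec_ne h]

theorem matEntry_rankOne {X : Type*} (v w : EllTwo X) (x y : X) :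
    matEntry (rankOne ℂ v w) x y = v x * starRingEnd ℂ (w y) := by
  simp [matEntry, ← inner_deltaVec y w, mul_comm]

theorem ext_deltaVec {X : Type*} {a b : BoundedOp X}
    (h : ∀ x, a (deltaVec x) = b (deltaVec x)) : a = b := by
  classical
  ext1 v
  have hv := lp.hasSum_single (p := 2) (by norm_num) v
  refine (a.hasSum hv).unique ?_
  convert b.hasSum hv using 2 with x
  simp only [single_eq_smul_deltaVec, map_smul, h]

/-! ### Matrix units in the uniform Roe algebra -/

section Membership

variable {X : Type*} [MetricSpace X]

theorem mem_uniformRoeAlgebra_of_hasFinitePropagation {a : BoundedOp X}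
    (ha : HasFinitePropagation a) : a ∈ uniformRoeAlgebra X :=
  (finitePropagationAlgebra X).le_topologicalClosure ha

theorem diagOp_mem (s : X → ℂ) (hs : ∀ x, ‖s x‖ ≤ 1) : diagOp s hs ∈ uniformRoeAlgebra X := by
  refine mem_uniformRoeAlgebra_of_hasFinitePropagation ⟨0, fun x y hxy => ?_⟩
  by_contra hd
  have hne : x ≠ y := fun h => hd (by rw [h, dist_self])
  exact hxy (by simp [matEntry, deltaVec_ne hne])

theorem rankOne_deltaVec_mem (x y : X) :
    rankOne ℂ (deltaVec x) (deltaVec y : EllTwo X) ∈ uniformRoeAlgebra X := by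
  refine mem_uniformRoeAlgebra_of_hasFinitePropagation ⟨dist x y, fun z w hzw => ?_⟩
  rw [matEntry_rankOne] at hzw
  have h1 : z = x := by
    by_contra h
    exact hzw (by rw [deltaVec_ne h, zero_mul])
  have h2 : w = y := by
    by_contra h
    exact hzw (by rw [deltaVec_ne h, map_zero, mul_zero])
  rw [h1, h2]

/-- Truncating `v` to finite sets gives norm limits of combinations of matrix units. This supplies
the test operators for completeness of the frame. -/
theorem rankOne_mem (v : EllTwo X) (y : X) :
    rankOne ℂ v (deltaVec y : EllTwo X) ∈ uniformRoeAlgebra X := by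
  classical
  have hv := lp.hasSum_single (p := 2) (by norm_num) v
  have h := ((rankOne ℂ (E := EllTwo X) (F := EllTwo X)).flip (deltaVec y)).hasSum hv
  have hcl : IsClosed (uniformRoeAlgebra X : Set (BoundedOp X)) :=
    (finitePropagationAlgebra X).isClosed_topologicalClosure
  refine hcl.mem_of_tendsto h (Eventually.of_forall fun F => ?_)
  refine sum_mem fun x _ => ?_
  simp only [ContinuousLinearMap.flip_apply, single_eq_smul_deltaVec, map_smul]
  exact (uniformRoeAlgebra X).smul_mem (rankOne_deltaVec_mem x y) _

/-- The matrix unit `e_{xy}` as an element of the uniform Roe algebra. -/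
noncomputable def matUnit (x y : X) : uniformRoeAlgebra X :=
  ⟨rankOne ℂ (deltaVec x) (deltaVec y), rankOne_deltaVec_mem x y⟩

theorem matUnit_apply (x y : X) (v : EllTwo X) :
    (matUnit x y : BoundedOp X) v = v y • deltaVec x := by
  rw [matUnit, rankOne_apply, inner_deltaVec]

theorem matUnit_mul_mul (a : uniformRoeAlgebra X) (x y : X) :
    matUnit x x * a * matUnit y y = matEntry (a : BoundedOp X) x y • matUnit x y := by
  refine Subtype.ext (ContinuousLinearMap.ext fun v => ?_)
  simp [matUnit_apply, matEntry, smul_smul, mul_comm]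

theorem star_matUnit (x y : X) : star (matUnit x y) = matUnit y x := by
  refine Subtype.ext ?_
  simp only [StarMemClass.coe_star, matUnit, ContinuousLinearMap.star_eq_adjoint, adjoint_rankOne]

theorem matUnit_mul (x y z : X) : matUnit x y * matUnit y z = matUnit x z := by
  refine Subtype.ext (ContinuousLinearMap.ext fun v => ?_)
  simp [matUnit_apply, deltaVec_self]

theorem matUnit_mul_of_ne {x x' y y' : X} (h : y ≠ x') : matUnit x y * matUnit x' y' = 0 := by
  refine Subtype.ext (ContinuousLinearMap.ext fun v => ?_)
  simp [matUnit_apply, deltaVec_ne h]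

theorem matUnit_ne_zero (x y : X) : matUnit x y ≠ 0 := by
  intro h
  have h1 := matUnit_apply x y (deltaVec y)
  rw [h, deltaVec_self, one_smul] at h1
  have h2 := norm_deltaVec x
  rw [← h1] at h2
  simp at h2

end Membership

/-! ### Coordinate projections and decay off the diagonal -/

section Cutoff

open Classical in
/-- The projection of `ℓ₂(X)` onto `ℓ₂(S)`. -/
noncomputable def cutoff {X : Type*} (S : Set X) : BoundedOp X :=
  diagOp (S.indicator 1) fun x => by by_cases h : x ∈ S <;> simp [h]

theorem cutoff_apply_mem {X : Type*} {S : Set X} {x : X} (hx : x ∈ S) (v : EllTwo X) :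
    cutoff S v x = v x := by
  simp [cutoff, hx]

theorem cutoff_apply_notMem {X : Type*} {S : Set X} {x : X} (hx : x ∉ S) (v : EllTwo X) :
    cutoff S v x = 0 := by
  simp [cutoff, hx]

theorem norm_cutoff_le {X : Type*} (S : Set X) (v : EllTwo X) : ‖cutoff S v‖ ≤ ‖v‖ :=
  norm_diagOp_apply_le _ _ v

theorem cutoff_add_cutoff_compl {X : Type*} (S : Set X) (v : EllTwo X) :
    cutoff S v + cutoff Sᶜ v = v := by
  ext x
  by_cases h : x ∈ S
  · rw [lp.coeFn_add, Pi.add_apply, cutoff_apply_mem h, cutoff_apply_notMem (by simpa using h),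
      add_zero]
  · rw [lp.coeFn_add, Pi.add_apply, cutoff_apply_notMem h, cutoff_apply_mem (by simpa using h),
      zero_add]

theorem cutoff_finset_eq_sum {X : Type*} (S : Finset X) (v : EllTwo X) :
    cutoff (S : Set X) v = ∑ z ∈ S, v z • deltaVec z := by
  classical
  ext x
  rw [lp.coeFn_sum, Finset.sum_apply]
  by_cases h : x ∈ S
  · rw [cutoff_apply_mem (by simpa using h), Finset.sum_eq_single x]
    · simp [deltaVec_self]
    · intro z _ hz
      simp [deltaVec_ne hz.symm]
    · exact fun h' => absurd h h'
  · rw [cutoff_apply_notMem (by simpa using h), Finset.sum_eq_zero]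
    intro z hz
    simp [deltaVec_ne (show x ≠ z from fun h' => h (h' ▸ hz))]

theorem norm_cutoff_finset_sq {X : Type*} (S : Finset X) (v : EllTwo X) :
    ‖cutoff (S : Set X) v‖ ^ 2 = ∑ z ∈ S, ‖v z‖ ^ 2 := by
  have h := lp.norm_rpow_eq_tsum (p := 2) (by norm_num) (cutoff (S : Set X) v)
  simp only [ENNReal.toReal_ofNat, Real.rpow_ofNat] at h
  rw [h, tsum_eq_sum (s := S)]
  · exact Finset.sum_congr rfl fun z hz => by rw [cutoff_apply_mem (by simpa using hz)]
  · intro z hz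
    rw [cutoff_apply_notMem (by simpa using hz)]
    simp

/-- Up to `η`, each column of `a` is supported within distance `r` of the diagonal. -/
def ColumnDecay {X : Type*} [MetricSpace X] (a : BoundedOp X) (r η : ℝ) : Prop :=
  ∀ y, ‖cutoff {z | r < dist z y} (a (deltaVec y))‖ ≤ η

variable {X : Type*} [MetricSpace X]

theorem ColumnDecay.mono_radius {a : BoundedOp X} {r r' η : ℝ} (h : ColumnDecay a r η)
    (hr : r ≤ r') : ColumnDecay a r' η := by
  intro y
  refine le_trans (lp.norm_mono (p := 2) (by norm_num) fun x => ?_) (h y)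
  by_cases hx : r' < dist x y
  · rw [cutoff_apply_mem (S := {z | r' < dist z y}) hx,
      cutoff_apply_mem (S := {z | r < dist z y}) (hr.trans_lt hx)]
  · rw [cutoff_apply_notMem (S := {z | r' < dist z y}) hx, norm_zero]
    exact norm_nonneg _

theorem ColumnDecay.mono {a : BoundedOp X} {r η η' : ℝ} (h : ColumnDecay a r η)
    (hη : η ≤ η') : ColumnDecay a r η' := fun y => (h y).trans hη

theorem ColumnDecay.add {a b : BoundedOp X} {r η η' : ℝ} (ha : ColumnDecay a r η)
    (hb : ColumnDecay b r η') : ColumnDecay (a + b) r (η + η') := fun y => by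
  rw [add_apply, map_add]
  exact (norm_add_le _ _).trans (add_le_add (ha y) (hb y))

theorem ColumnDecay.smul {a : BoundedOp X} {r η : ℝ} (ha : ColumnDecay a r η) (c : ℂ) :
    ColumnDecay (c • a) r (‖c‖ * η) := fun y => by
  rw [smul_apply, map_smul, norm_smul]
  exact mul_le_mul_of_nonneg_left (ha y) (norm_nonneg _)

theorem ColumnDecay.sum {ι : Type*} {a : ι → BoundedOp X} {r : ℝ} {η : ι → ℝ} (F : Finset ι)
    (ha : ∀ i ∈ F, ColumnDecay (a i) r (η i)) :
    ColumnDecay (∑ i ∈ F, a i) r (∑ i ∈ F, η i) := fun y => by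
  rw [sum_apply, map_sum]
  exact norm_sum_le_of_le _ fun i hi => ha i hi y

theorem exists_columnDecay {a : BoundedOp X} (ha : a ∈ uniformRoeAlgebra X) {η : ℝ} (hη : 0 < η) :
    ∃ r, ColumnDecay a r η := by
  obtain ⟨b, ⟨r, hr⟩, hb⟩ := Metric.mem_closure_iff.1 ha η hη
  refine ⟨r, fun y => ?_⟩
  have h0 : cutoff {z | r < dist z y} (b (deltaVec y)) = 0 := by
    ext x
    by_cases hx : r < dist x y
    · rw [cutoff_apply_mem (S := {z | r < dist z y}) hx]
      by_contra h
      exact hx.not_ge (hr x y h)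
    · rw [cutoff_apply_notMem (S := {z | r < dist z y}) hx]
      rfl
  calc ‖cutoff {z | r < dist z y} (a (deltaVec y))‖
      = ‖cutoff {z | r < dist z y} ((a - b) (deltaVec y))‖ := by
        rw [sub_apply, map_sub, h0, sub_zero]
    _ ≤ ‖(a - b) (deltaVec y)‖ := norm_cutoff_le _ _
    _ ≤ ‖a - b‖ * ‖(deltaVec y : EllTwo X)‖ := (a - b).le_opNorm _
    _ ≤ η := by rw [norm_deltaVec, mul_one, ← dist_eq_norm]; exact hb.le

end Cutoff

/-! ### Choice of signs and diagonal sign operators -/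

/-- Finitely many vectors can be given signs so that the squared norm of the signed sum is at most
the sum of the squared norms. -/
theorem exists_signs_norm_sum_sq_le {ι E : Type*} [NormedAddCommGroup E] [InnerProductSpace ℂ E]
    (F : Finset ι) (v : ι → E) :
    ∃ s : ι → Bool, ‖∑ i ∈ F, (if s i then 1 else -1 : ℂ) • v i‖ ^ 2 ≤ ∑ i ∈ F, ‖v i‖ ^ 2 := by
  classical
  induction F using Finset.induction_on with
  | empty => exact ⟨fun _ => true, by simp⟩
  | insert j F hj ih =>
    obtain ⟨s, hs⟩ := ih
    set S := ∑ i ∈ F, (if s i then 1 else -1 : ℂ) • v i with hS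
    have key (b : Bool) : ∑ i ∈ insert j F, (if Function.update s j b i then 1 else -1 : ℂ) • v i =
        (if b then 1 else -1 : ℂ) • v j + S := by
      rw [Finset.sum_insert hj, Function.update_self, hS]
      congr 1
      refine Finset.sum_congr rfl fun i hi => ?_
      rw [Function.update_of_ne (ne_of_mem_of_not_mem hi hj)]
    rw [Finset.sum_insert hj]
    have par := parallelogram_law_with_norm ℂ (v j) S
    rcases le_total ‖v j + S‖ ‖v j - S‖ with h | h
    · refine ⟨Function.update s j true, ?_⟩
      rw [key]
      simp only [if_true, one_smul]
      nlinarith [norm_nonneg (v j + S)]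
    · refine ⟨Function.update s j false, ?_⟩
      rw [key]
      have : ‖(if false = true then 1 else -1 : ℂ) • v j + S‖ = ‖v j - S‖ := by
        rw [← norm_neg]; simp [sub_eq_add_neg, add_comm]
      rw [this]
      nlinarith [norm_nonneg (v j - S)]

section Signs

variable {X : Type*} [MetricSpace X]

/-- The diagonal unitary with entries `1` where `s` is true and `-1` elsewhere. -/
noncomputable def signOp (s : X → Bool) : uniformRoeAlgebra X :=
  ⟨diagOp (fun x => if s x then 1 else -1) fun x => by split_ifs <;> simp, diagOp_mem _ _⟩

theorem signOp_deltaVec (s : X → Bool) (x : X) :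
    (signOp s : BoundedOp X) (deltaVec x) = (if s x then 1 else -1 : ℂ) • deltaVec x :=
  diagOp_deltaVec _ (fun x => by split_ifs <;> simp) x

theorem signOp_mul_matUnit (s : X → Bool) (x : X) :
    signOp s * matUnit x x = (if s x then 1 else -1 : ℂ) • matUnit x x := by
  refine Subtype.ext (ContinuousLinearMap.ext fun v => ?_)
  simp only [MulMemClass.coe_mul, mul_apply_eq_comp, matUnit_apply, map_smul,
    signOp_deltaVec, SetLike.val_smul, smul_apply]
  rw [smul_comm]

theorem star_signOp_mul_self (s : X → Bool) : star (signOp s) * signOp s = 1 := by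
  refine Subtype.ext (ext_deltaVec fun y => ?_)
  ext x
  change matEntry (star (signOp s : BoundedOp X) * (signOp s : BoundedOp X)) x y =
    (deltaVec y : EllTwo X) x
  have h : matEntry (star (signOp s : BoundedOp X) * (signOp s : BoundedOp X)) x y =
      (if s y then 1 else -1) * matEntry (star (signOp s : BoundedOp X)) x y := by
    rw [matEntry, mul_apply_eq_comp, signOp_deltaVec, map_smul]
    rfl
  rw [h, matEntry_star, matEntry, signOp_deltaVec]
  by_cases hxy : x = y
  · subst hxy
    rw [lp.coeFn_smul, Pi.smul_apply, deltaVec_self]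
    split_ifs <;> simp
  · rw [lp.coeFn_smul, Pi.smul_apply, deltaVec_ne hxy, deltaVec_ne (Ne.symm hxy)]
    simp

/-- Allows finitely many coordinates of a sign pattern to be corrected at the cost of finitely many
matrix units. -/
theorem signOp_eq_add_sum (s t : X → Bool) (I : Finset X) (h : ∀ x ∉ I, s x = t x) :
    signOp s = signOp t + ∑ x ∈ I,
      ((if s x then 1 else -1 : ℂ) - (if t x then 1 else -1 : ℂ)) • matUnit x x := by
  classical
  refine Subtype.ext (ext_deltaVec fun y => ?_)
  simp only [AddMemClass.coe_add, AddSubmonoidClass.coe_finsetSum, SetLike.val_smul, add_apply,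
    sum_apply, smul_apply, matUnit_apply, signOp_deltaVec]
  by_cases hy : y ∈ I
  · rw [Finset.sum_eq_single_of_mem y hy fun x _ hx => by simp [deltaVec_ne hx], deltaVec_self,
      one_smul, ← add_smul]
    congr 1
    ring
  · rw [Finset.sum_eq_zero fun x hx => by
      simp [deltaVec_ne (show x ≠ y from fun h' => hy (h' ▸ hx))], h y hy, add_zero]

end Signs

/-! ### The orthonormal basis transported by the isomorphism -/

section Isomorphism

variable {X Y : Type*} [MetricSpace X] [MetricSpace Y]

theorem star_coe_map (Φ : uniformRoeAlgebra X ≃⋆ₐ[ℂ] uniformRoeAlgebra Y)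
    (a : uniformRoeAlgebra X) : star (Φ a : BoundedOp Y) = Φ (star a) :=
  congrArg Subtype.val (Φ.map_star' a).symm

/-- Compressing a diagonal matrix unit by `q` gives the rank-one operator of `η = q (deltaVec y)`
with itself; minimality makes it a multiple of `q`, nonzero once `η ≠ 0`. -/
theorem exists_rankOne_of_minimal {q : BoundedOp Y} (hq : star q = q) (hqq : q * q = q)
    (h0 : q ≠ 0) (hmin : ∀ b ∈ uniformRoeAlgebra Y, ∃ c : ℂ, q * b * q = c • q) :
    ∃ ξ : EllTwo Y, ‖ξ‖ = 1 ∧ q = rankOne ℂ ξ ξ := by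
  obtain ⟨y, hy⟩ : ∃ y, q (deltaVec y) ≠ 0 := by
    by_contra! h
    exact h0 (ext_deltaVec h)
  set η := q (deltaVec y) with hη
  have hqη : q η = η := by rw [hη, ← mul_apply_eq_comp, hqq]
  have hsymm (v w : EllTwo Y) : inner ℂ v (q w) = inner ℂ (q v) w := by
    rw [← ContinuousLinearMap.adjoint_inner_left, ← ContinuousLinearMap.star_eq_adjoint, hq]
  obtain ⟨c, hc⟩ := hmin _ (rankOne_deltaVec_mem y y)
  have hc' (v : EllTwo Y) : inner ℂ η v • η = c • q v := by
    have h := congrArg (fun T : BoundedOp Y => T v) hc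
    simp only [mul_apply_eq_comp, rankOne_apply, map_smul, smul_apply] at h
    rwa [hsymm] at h
  have hη0 : (‖η‖ : ℂ) ≠ 0 := by simpa using hy
  have hcη : c = (‖η‖ : ℂ) ^ 2 := by
    have h := hc' η
    rw [hqη, inner_self_eq_norm_sq_to_K] at h
    exact (smul_left_injective ℂ hy h).symm
  refine ⟨(‖η‖ : ℂ)⁻¹ • η, ?_, ContinuousLinearMap.ext fun v => ?_⟩
  · rw [norm_smul, norm_inv, Complex.norm_real, norm_norm]
    exact inv_mul_cancel₀ (by simpa using hy)
  · have h : q v = ((‖η‖ : ℂ) ^ 2)⁻¹ • inner ℂ η v • η := by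
      rw [hc', hcη, inv_smul_smul₀ (pow_ne_zero 2 hη0)]
    rw [h, rankOne_apply, inner_smul_left, smul_smul, smul_smul]
    congr 1
    simp only [map_inv₀, Complex.conj_ofReal]
    ring

/-- `ξ` is a family of unit vectors spanning the ranges of the images under `Φ` of the diagonal
matrix units. -/
def IsImageFrame (Φ : uniformRoeAlgebra X ≃⋆ₐ[ℂ] uniformRoeAlgebra Y) (ξ : X → EllTwo Y) : Prop :=
  ∀ x, ‖ξ x‖ = 1 ∧ (Φ (matUnit x x) : BoundedOp Y) = rankOne ℂ (ξ x) (ξ x)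

theorem exists_isImageFrame (Φ : uniformRoeAlgebra X ≃⋆ₐ[ℂ] uniformRoeAlgebra Y) :
    ∃ ξ : X → EllTwo Y, IsImageFrame Φ ξ := by
  refine Classical.skolem.1 fun x => exists_rankOne_of_minimal ?_ ?_ ?_ fun b hb => ?_
  · rw [star_coe_map, star_matUnit]
  · rw [← MulMemClass.coe_mul, ← map_mul, matUnit_mul]
  · intro h
    have h' : Φ (matUnit x x) = 0 := Subtype.ext h
    exact matUnit_ne_zero x x ((map_eq_zero_iff Φ (EquivLike.injective Φ)).1 h')
  · obtain ⟨a, ha⟩ := EquivLike.surjective Φ ⟨b, hb⟩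
    refine ⟨matEntry (a : BoundedOp X) x x, ?_⟩
    have h := congrArg Φ (matUnit_mul_mul a x x)
    rw [map_mul, map_mul, map_smul, ha] at h
    exact congrArg Subtype.val h

namespace IsImageFrame

variable {Φ : uniformRoeAlgebra X ≃⋆ₐ[ℂ] uniformRoeAlgebra Y} {ξ : X → EllTwo Y}

theorem apply_matUnit (h : IsImageFrame Φ ξ) (x : X) (v : EllTwo Y) :
    (Φ (matUnit x x) : BoundedOp Y) v = inner ℂ (ξ x) v • ξ x := by
  rw [(h x).2, rankOne_apply]

theorem apply_matUnit_self (h : IsImageFrame Φ ξ) (x : X) :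
    (Φ (matUnit x x) : BoundedOp Y) (ξ x) = ξ x := by
  rw [h.apply_matUnit, inner_self_eq_norm_sq_to_K, (h x).1]
  simp

theorem ne_zero (h : IsImageFrame Φ ξ) (x : X) : ξ x ≠ 0 := by
  rw [← norm_ne_zero_iff, (h x).1]
  exact one_ne_zero

theorem orthonormal (h : IsImageFrame Φ ξ) : Orthonormal ℂ ξ := by
  refine ⟨fun x => (h x).1, fun x x' hne => ?_⟩
  have h1 := congrArg Φ (matUnit_mul_of_ne (x := x) (y' := x') hne)
  rw [map_mul, map_zero] at h1
  have h2 := congrArg (fun T : uniformRoeAlgebra Y => (T : BoundedOp Y) (ξ x')) h1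
  simp only [MulMemClass.coe_mul, mul_apply_eq_comp, h.apply_matUnit_self,
    h.apply_matUnit, ZeroMemClass.coe_zero, zero_apply] at h2
  exact (smul_eq_zero.1 h2).resolve_right (h.ne_zero x)

/-- If `v` is orthogonal to the frame, the preimage of a rank-one operator with range spanned by `v`
is killed on the left by every `matUnit x x`, so all its rows vanish. -/
theorem eq_zero_of_inner_eq_zero (h : IsImageFrame Φ ξ) {v : EllTwo Y}
    (hv : ∀ x, inner ℂ (ξ x) v = 0) : v = 0 := by
  by_contra hv0
  -- Only the existence of a point of `Y` is kept.
  obtain ⟨y, -⟩ : ∃ y, v y ≠ 0 := by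
    by_contra! hz
    exact hv0 (by ext y; exact hz y)
  let T : uniformRoeAlgebra Y := ⟨rankOne ℂ v (deltaVec y), rankOne_mem v y⟩
  have hT (x : X) : matUnit x x * Φ.symm T = 0 := by
    refine EquivLike.injective Φ ?_
    rw [map_mul, map_zero, StarAlgEquiv.apply_symm_apply]
    refine Subtype.ext (ContinuousLinearMap.ext fun w => ?_)
    simp [T, h.apply_matUnit, hv]
  have hT0 : Φ.symm T = 0 := by
    refine Subtype.ext (ContinuousLinearMap.ext fun w => ?_)
    ext x
    have h1 := congrArg (fun S : uniformRoeAlgebra X => (S : BoundedOp X) w) (hT x)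
    simp only [MulMemClass.coe_mul, mul_apply_eq_comp, matUnit_apply,
      ZeroMemClass.coe_zero, zero_apply] at h1
    have h2 : deltaVec x ≠ (0 : EllTwo X) := by
      rw [← norm_ne_zero_iff, norm_deltaVec]
      exact one_ne_zero
    exact (smul_eq_zero.1 h1).resolve_right h2
  have hT1 : T = 0 := by
    rw [← StarAlgEquiv.apply_symm_apply Φ T, hT0, map_zero]
  have h3 := congrArg (fun S : uniformRoeAlgebra Y => (S : BoundedOp Y) (deltaVec y)) hT1
  simp only [T, rankOne_apply, inner_deltaVec, deltaVec_self, one_smul] at h3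
  exact hv0 h3

/-- The family `ξ` as a Hilbert basis. -/
noncomputable def hilbertBasis (h : IsImageFrame Φ ξ) : HilbertBasis X ℂ (EllTwo Y) :=
  HilbertBasis.mkOfOrthogonalEqBot h.orthonormal <| by
    refine (Submodule.eq_bot_iff _).2 fun v hv => h.eq_zero_of_inner_eq_zero fun x => ?_
    exact (Submodule.mem_orthogonal _ _).1 hv _ (Submodule.subset_span ⟨x, rfl⟩)

theorem coe_hilbertBasis (h : IsImageFrame Φ ξ) : ⇑h.hilbertBasis = ξ :=
  HilbertBasis.coe_mkOfOrthogonalEqBot _ _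

/-- `Φ (matUnit x x')` is a partial isometry sending `ξ x'` to a unit vector, so evaluating the
image of `matUnit_mul_mul` at `ξ x'` compares the two moduli. -/
theorem norm_matEntry (h : IsImageFrame Φ ξ) (a : uniformRoeAlgebra X) (x x' : X) :
    ‖matEntry (a : BoundedOp X) x x'‖ = ‖inner ℂ (ξ x) ((Φ a : BoundedOp Y) (ξ x'))‖ := by
  set t : BoundedOp Y := (Φ (matUnit x x') : BoundedOp Y) with ht
  have htt : star t * t = Φ (matUnit x' x') := by
    rw [ht, star_coe_map, star_matUnit, ← MulMemClass.coe_mul, ← map_mul,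
      matUnit_mul]
  have hnorm : ‖t (ξ x')‖ = 1 := by
    have h1 : inner ℂ (t (ξ x')) (t (ξ x')) = (1 : ℂ) := by
      rw [← ContinuousLinearMap.adjoint_inner_right, ← ContinuousLinearMap.star_eq_adjoint,
        ← mul_apply_eq_comp, htt, h.apply_matUnit_self, inner_self_eq_norm_sq_to_K,
        (h x').1]
      simp
    rw [norm_eq_sqrt_re_inner (𝕜 := ℂ), h1]
    simp
  have h2 := congrArg Φ (matUnit_mul_mul a x x')
  rw [map_mul, map_mul, map_smul] at h2
  have h3 := congrArg (fun S : uniformRoeAlgebra Y => ‖(S : BoundedOp Y) (ξ x')‖) h2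
  simp only [MulMemClass.coe_mul, mul_apply_eq_comp, h.apply_matUnit_self,
    SetLike.val_smul, smul_apply, norm_smul] at h3
  rw [← ht, hnorm, h.apply_matUnit, norm_smul, (h x).1] at h3
  linarith

/-- Both squares are the modulus of the diagonal entry at `x` of `Φ.symm (matUnit y y)`. -/
theorem norm_apply_eq_symm (h : IsImageFrame Φ ξ) {ζ : Y → EllTwo X} (hζ : IsImageFrame Φ.symm ζ)
    (x : X) (y : Y) : ‖ξ x y‖ = ‖ζ y x‖ := by
  have h1 := h.norm_matEntry (Φ.symm (matUnit y y)) x x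
  rw [StarAlgEquiv.apply_symm_apply, (hζ y).2, matEntry_rankOne, matUnit_apply, inner_smul_right,
    ← inner_conj_symm, inner_deltaVec, norm_mul, norm_mul, RCLike.norm_conj, RCLike.norm_conj] at h1
  nlinarith [norm_nonneg (ξ x y), norm_nonneg (ζ y x)]

theorem signOp_apply_frame (h : IsImageFrame Φ ξ) (s : X → Bool) (x : X) :
    (Φ (signOp s) : BoundedOp Y) (ξ x) = (if s x then 1 else -1 : ℂ) • ξ x := by
  have h1 := congrArg Φ (signOp_mul_matUnit s x)
  rw [map_mul, map_smul] at h1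
  have h2 := congrArg (fun S : uniformRoeAlgebra Y => (S : BoundedOp Y) (ξ x)) h1
  simpa only [MulMemClass.coe_mul, mul_apply_eq_comp, h.apply_matUnit_self,
    SetLike.val_smul, smul_apply] using h2

end IsImageFrame

/-! ### Uniform decay by Baire category -/

theorem norm_map_signOp_apply (Φ : uniformRoeAlgebra X ≃⋆ₐ[ℂ] uniformRoeAlgebra Y) (s : X → Bool)
    (v : EllTwo Y) : ‖(Φ (signOp s) : BoundedOp Y) v‖ = ‖v‖ := by
  have h : star (Φ (signOp s) : BoundedOp Y) * (Φ (signOp s) : BoundedOp Y) = 1 := by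
    rw [star_coe_map, ← MulMemClass.coe_mul, ← map_mul,
      star_signOp_mul_self, map_one]
    rfl
  rw [norm_eq_sqrt_re_inner (𝕜 := ℂ), norm_eq_sqrt_re_inner (𝕜 := ℂ) v,
    ← ContinuousLinearMap.adjoint_inner_right, ← ContinuousLinearMap.star_eq_adjoint,
    ← mul_apply_eq_comp, h, one_apply_eq_self]

namespace IsImageFrame

variable {Φ : uniformRoeAlgebra X ≃⋆ₐ[ℂ] uniformRoeAlgebra Y} {ξ : X → EllTwo Y}

/-- In the frame the inner product is a series whose terms depend on one sign each and are
dominated, uniformly in `s`, by a summable family. -/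
theorem continuous_inner_signOp (h : IsImageFrame Φ ξ) (u v : EllTwo Y) :
    Continuous fun s : X → Bool => (inner ℂ u ((Φ (signOp s) : BoundedOp Y) v) : ℂ) := by
  have hb := h.coe_hilbertBasis
  have hs := h.hilbertBasis.summable_inner_mul_inner u v
  rw [hb] at hs
  have hrep (s : X → Bool) : (inner ℂ u ((Φ (signOp s) : BoundedOp Y) v) : ℂ) =
      ∑' x, (if s x then 1 else -1 : ℂ) * (inner ℂ u (ξ x) * inner ℂ (ξ x) v) := by
    have h1 := (innerSL ℂ u ∘L (Φ (signOp s) : BoundedOp Y)).hasSum (h.hilbertBasis.hasSum_repr v)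
    refine h1.tsum_eq.symm.trans (tsum_congr fun x => ?_)
    rw [HilbertBasis.repr_apply_apply, hb, map_smul,
      ContinuousLinearMap.comp_apply, h.signOp_apply_frame, innerSL_apply_apply, inner_smul_right,
      smul_eq_mul]
    ring
  simp_rw [hrep]
  refine continuous_tsum (fun x => ?_) hs.norm fun x s => ?_
  · exact ((continuous_of_discreteTopology (f := fun b : Bool => (if b then 1 else -1 : ℂ))).comp
      (continuous_apply x)).mul continuous_const
  · rw [norm_mul]
    refine mul_le_of_le_one_left (norm_nonneg _) ?_
    split_ifs <;> simp

/-- Testing the column norms against all vectors `u` turns the condition into an intersection of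
closed conditions on inner products. -/
theorem isClosed_columnDecay_signOp (h : IsImageFrame Φ ξ) (r η : ℝ) :
    IsClosed {s : X → Bool | ColumnDecay (Φ (signOp s) : BoundedOp Y) r η} := by
  have heq : {s : X → Bool | ColumnDecay (Φ (signOp s) : BoundedOp Y) r η} =
      ⋂ (y : Y) (u : EllTwo Y), {s | ‖(inner ℂ (star (cutoff {z | r < dist z y}) u)
        ((Φ (signOp s) : BoundedOp Y) (deltaVec y)) : ℂ)‖ ≤ ‖u‖ * η} := by
    ext s
    simp only [Set.mem_ofPred_eq, Set.mem_iInter, ContinuousLinearMap.star_eq_adjoint,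
      ContinuousLinearMap.adjoint_inner_left]
    refine forall_congr' fun y => ⟨fun hs u => ?_, fun hs => ?_⟩
    · exact (norm_inner_le_norm _ _).trans (mul_le_mul_of_nonneg_left hs (norm_nonneg _))
    · set w := cutoff {z | r < dist z y} ((Φ (signOp s) : BoundedOp Y) (deltaVec y))
      have h1 := hs w
      rw [inner_self_eq_norm_sq_to_K] at h1
      rcases (norm_nonneg w).eq_or_lt with h0 | h0
      -- When `w = 0` the claim is `0 ≤ η`, which testing against a unit vector provides.
      · have h2 := hs (deltaVec y)
        rw [norm_deltaVec, one_mul] at h2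
        rw [← h0]
        exact (norm_nonneg _).trans h2
      · rw [norm_pow, RCLike.norm_ofReal, abs_norm, sq] at h1
        exact le_of_mul_le_mul_left h1 h0
  rw [heq]
  exact isClosed_iInter fun y => isClosed_iInter fun u =>
    isClosed_le (h.continuous_inner_signOp _ _).norm continuous_const

/-- The images of the diagonal sign operators decay off the diagonal at a common rate. -/
theorem exists_columnDecay_signOp (h : IsImageFrame Φ ξ) {η : ℝ} (hη : 0 < η) :
    ∃ r, ∀ s : X → Bool, ColumnDecay (Φ (signOp s) : BoundedOp Y) r η := by
  classical
  -- The patterns decaying at integer radius `n` form closed sets covering `X → Bool`, so one of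
  -- them has interior.
  obtain ⟨n, s₀, hs₀⟩ := nonempty_interior_of_iUnion_of_closed
    (f := fun n : ℕ => {s : X → Bool | ColumnDecay (Φ (signOp s) : BoundedOp Y) n (η / 2)})
    (fun n => h.isClosed_columnDecay_signOp n (η / 2)) (by
      refine Set.eq_univ_of_forall fun s => ?_
      obtain ⟨r, hr⟩ := exists_columnDecay (Φ (signOp s)).2 (half_pos hη)
      obtain ⟨n, hn⟩ := exists_nat_ge r
      exact Set.mem_iUnion.2 ⟨n, hr.mono_radius hn⟩)
  obtain ⟨I, u, hu, hsub⟩ := isOpen_pi_iff.1 isOpen_interior s₀ hs₀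
  -- At most `I.card` corrections occur, with coefficients of modulus at most 2, so their total
  -- error is at most `η / 2`.
  have hε : 0 < η / (4 * (I.card + 1)) := by positivity
  choose ρ hρ using fun x : X => exists_columnDecay (Φ (matUnit x x)).2 hε
  refine ⟨n + ∑ x ∈ I, |ρ x|, fun s => ?_⟩
  -- The basic open set restricts only the coordinates in `I`; copying `s₀` there puts `t` in it.
  set t : X → Bool := I.piecewise s₀ s with ht
  have htd : ColumnDecay (Φ (signOp t) : BoundedOp Y) n (η / 2) := by
    refine interior_subset (hsub fun x hx => ?_)
    rw [ht, Finset.piecewise_eq_of_mem _ _ _ hx]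
    exact (hu x hx).2
  have hsum : (Φ (signOp s) : BoundedOp Y) = Φ (signOp t) + ∑ x ∈ I,
      ((if s x then 1 else -1 : ℂ) - (if t x then 1 else -1 : ℂ)) •
        (Φ (matUnit x x) : BoundedOp Y) := by
    rw [signOp_eq_add_sum s t I fun x hx => by rw [ht, Finset.piecewise_eq_of_notMem _ _ _ hx],
      map_add, map_sum]
    simp only [map_smul, AddMemClass.coe_add, AddSubmonoidClass.coe_finsetSum, SetLike.val_smul]
  rw [hsum]
  have hn : (n : ℝ) ≤ n + ∑ x ∈ I, |ρ x| :=
    le_add_of_nonneg_right (Finset.sum_nonneg fun x _ => abs_nonneg _)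
  refine ((htd.mono_radius hn).add (ColumnDecay.sum I fun x hx => ((hρ x).mono_radius
    ?_).smul _)).mono ?_
  · have h1 := Finset.single_le_sum (f := fun x => |ρ x|) (fun x _ => abs_nonneg _) hx
    have h2 := le_abs_self (ρ x)
    have h3 : (0 : ℝ) ≤ n := n.cast_nonneg
    linarith
  · have hbound : ∑ x ∈ I, ‖(if s x then 1 else -1 : ℂ) - (if t x then 1 else -1 : ℂ)‖ *
        (η / (4 * (I.card + 1))) ≤ ∑ x ∈ I, 2 * (η / (4 * (I.card + 1))) := by
      refine Finset.sum_le_sum fun x _ => mul_le_mul_of_nonneg_right ?_ hε.le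
      split_ifs <;> norm_num
    have hle : ∑ x ∈ I, 2 * (η / (4 * (I.card + 1))) ≤ η / 2 := by
      rw [Finset.sum_const, nsmul_eq_mul]
      have hI : (0 : ℝ) < I.card + 1 := by positivity
      rw [show (I.card : ℝ) * (2 * (η / (4 * (I.card + 1)))) =
        (η / 2) * (I.card / (I.card + 1)) by field_simp; ring]
      refine mul_le_of_le_one_right (half_pos hη).le ((div_le_one hI).2 (by linarith))
    linarith

/-- Flipping one sign of the identity shows that `2 • matUnit x x` is a difference of two sign
operators. -/
theorem exists_columnDecay_matUnit (h : IsImageFrame Φ ξ) {η : ℝ} (hη : 0 < η) :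
    ∃ r, ∀ x, ColumnDecay (Φ (matUnit x x) : BoundedOp Y) r η := by
  classical
  obtain ⟨r, hr⟩ := h.exists_columnDecay_signOp hη
  refine ⟨r, fun x => ?_⟩
  set s : X → Bool := fun _ => true
  set t : X → Bool := fun z => decide (z ≠ x)
  have h1 : signOp s = signOp t + (2 : ℂ) • matUnit x x := by
    rw [signOp_eq_add_sum s t {x} fun z hz => by simpa [s, t] using hz]
    simp only [Finset.sum_singleton, s, t]
    norm_num
  have h2 : (Φ (matUnit x x) : BoundedOp Y) =
      (1 / 2 : ℂ) • (Φ (signOp s) : BoundedOp Y) + (-1 / 2 : ℂ) • (Φ (signOp t) : BoundedOp Y) := by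
    rw [h1, map_add, map_smul, AddMemClass.coe_add, SetLike.val_smul]
    module
  rw [h2]
  refine (((hr s).smul _).add ((hr t).smul _)).mono (le_of_eq ?_)
  norm_num
  ring

end IsImageFrame

/-! ### Bounded geometry and localization of the frame -/

theorem UniformlyLocallyFinite.exists_finset_closedBall (hY : UniformlyLocallyFinite Y) (r : ℝ) :
    ∃ N : ℕ, ∀ y : Y, ∃ B : Finset Y, (B : Set Y) = Metric.closedBall y r ∧ B.card ≤ N := by
  obtain ⟨N, hN⟩ := hY (max r 1) (by positivity)
  refine ⟨N, fun y => ?_⟩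
  have hle : (Metric.closedBall y r).encard ≤ N :=
    (Set.encard_le_encard (Metric.closedBall_subset_closedBall (le_max_left r 1))).trans (hN y)
  have hfin : (Metric.closedBall y r).Finite := Set.finite_of_encard_le_coe hle
  refine ⟨hfin.toFinset, hfin.coe_toFinset, ?_⟩
  rw [hfin.encard_eq_coe_toFinset_card] at hle
  exact_mod_cast hle

theorem ColumnDecay.norm_sub_cutoff_le {a : BoundedOp Y} {r η : ℝ} (ha : ColumnDecay a r η) (y : Y)
    {B : Finset Y} (hB : (B : Set Y) = Metric.closedBall y r) :
    ‖a (deltaVec y) - cutoff (B : Set Y) (a (deltaVec y))‖ ≤ η := by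
  have hc : (B : Set Y)ᶜ = {z | r < dist z y} := by
    rw [hB]
    ext z
    simp
  nth_rewrite 1 [← cutoff_add_cutoff_compl (B : Set Y) (a (deltaVec y))]
  rw [add_sub_cancel_left, hc]
  exact ha y

namespace IsImageFrame

variable {Φ : uniformRoeAlgebra X ≃⋆ₐ[ℂ] uniformRoeAlgebra Y} {ξ : X → EllTwo Y}

theorem sum_norm_sq_le_one (h : IsImageFrame Φ ξ) (F : Finset X) (y : Y) :
    ∑ x ∈ F, ‖ξ x y‖ ^ 2 ≤ 1 := by
  have h1 := h.orthonormal.sum_inner_products_le (deltaVec y) (s := F)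
  rw [norm_deltaVec, one_pow] at h1
  refine le_trans (le_of_eq (Finset.sum_congr rfl fun x _ => ?_)) h1
  rw [← inner_conj_symm, RCLike.norm_conj, inner_deltaVec]

theorem finite_setOf_le_norm (h : IsImageFrame Φ ξ) {δ : ℝ} (hδ : 0 < δ) (y : Y) :
    {x | δ ≤ ‖ξ x y‖}.Finite := by
  have h1 := (h.orthonormal.inner_products_summable (deltaVec y)).tendsto_cofinite_zero
  have h2 := h1.eventually (gt_mem_nhds (pow_pos hδ 2))
  refine Set.Finite.subset h2 fun x hx hlt => ?_
  change ‖(inner ℂ (ξ x) (deltaVec y) : ℂ)‖ ^ 2 < δ ^ 2 at hlt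
  rw [← inner_conj_symm, RCLike.norm_conj, inner_deltaVec] at hlt
  exact hlt.not_ge (pow_le_pow_left₀ hδ.le hx 2)

theorem apply_matUnit_deltaVec (h : IsImageFrame Φ ξ) (x : X) (y : Y) :
    (Φ (matUnit x x) : BoundedOp Y) (deltaVec y) = starRingEnd ℂ (ξ x y) • ξ x := by
  rw [h.apply_matUnit, ← inner_conj_symm, inner_deltaVec]

/-- Every basis vector of `ℓ₂(Y)` has a coefficient bounded below with respect to the frame. -/
theorem exists_le_norm_apply (h : IsImageFrame Φ ξ) (hY : UniformlyLocallyFinite Y) :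
    ∃ δ : ℝ, 0 < δ ∧ ∀ y, ∃ x, δ ≤ ‖ξ x y‖ := by
  classical
  obtain ⟨r, hr⟩ := h.exists_columnDecay_signOp (η := 1 / 2) (by norm_num)
  obtain ⟨N, hN⟩ := hY.exists_finset_closedBall r
  -- This `δ` satisfies `δ ^ 2 * N < (1 / 4) ^ 2`.
  refine ⟨1 / (4 * (N + 1)), by positivity, fun y => ?_⟩
  by_contra! hlt
  obtain ⟨B, hB, hBN⟩ := hN y
  have hsum := h.hilbertBasis.hasSum_repr (deltaVec y)
  obtain ⟨F, hF⟩ := (hsum.eventually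
    (Metric.ball_mem_nhds _ (by norm_num : (0 : ℝ) < 1 / 4))).exists
  rw [dist_comm, dist_eq_norm] at hF
  simp only [HilbertBasis.repr_apply_apply, h.coe_hilbertBasis] at hF
  -- Signs are chosen after compressing to `B`; exchanging sums and applying Bessel at each of the
  -- at most `N` points of `B` then bounds the squared norm by `δ ^ 2 * N`.
  obtain ⟨s, hs⟩ := exists_signs_norm_sum_sq_le F
    fun x => cutoff (B : Set Y) ((inner ℂ (ξ x) (deltaVec y) : ℂ) • ξ x)
  set w : BoundedOp Y := (Φ (signOp s) : BoundedOp Y) with hw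
  set p : EllTwo Y := ∑ x ∈ F, (inner ℂ (ξ x) (deltaVec y) : ℂ) • ξ x with hp
  have hsq : ‖cutoff (B : Set Y) (w p)‖ ^ 2 ≤ (1 / (4 * (N + 1)) : ℝ) ^ 2 * N := by
    have hwp : cutoff (B : Set Y) (w p) = ∑ x ∈ F, (if s x then 1 else -1 : ℂ) •
        cutoff (B : Set Y) ((inner ℂ (ξ x) (deltaVec y) : ℂ) • ξ x) := by
      rw [hp, map_sum, map_sum]
      refine Finset.sum_congr rfl fun x _ => ?_
      rw [map_smul, hw, h.signOp_apply_frame, smul_comm, map_smul]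
    rw [hwp]
    refine hs.trans ?_
    calc ∑ x ∈ F, ‖cutoff (B : Set Y) ((inner ℂ (ξ x) (deltaVec y) : ℂ) • ξ x)‖ ^ 2
        = ∑ x ∈ F, ‖ξ x y‖ ^ 2 * ∑ z ∈ B, ‖ξ x z‖ ^ 2 := by
          refine Finset.sum_congr rfl fun x _ => ?_
          rw [map_smul, norm_smul, mul_pow, norm_cutoff_finset_sq, ← inner_conj_symm,
            RCLike.norm_conj, inner_deltaVec]
      _ ≤ ∑ x ∈ F, (1 / (4 * (N + 1)) : ℝ) ^ 2 * ∑ z ∈ B, ‖ξ x z‖ ^ 2 := by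
          refine Finset.sum_le_sum fun x _ => mul_le_mul_of_nonneg_right ?_ (by positivity)
          exact pow_le_pow_left₀ (norm_nonneg _) (hlt x).le 2
      _ = (1 / (4 * (N + 1)) : ℝ) ^ 2 * ∑ z ∈ B, ∑ x ∈ F, ‖ξ x z‖ ^ 2 := by
          rw [← Finset.mul_sum, Finset.sum_comm]
      _ ≤ (1 / (4 * (N + 1)) : ℝ) ^ 2 * ∑ z ∈ B, 1 := by
          gcongr with z
          exact h.sum_norm_sq_le_one F z
      _ ≤ (1 / (4 * (N + 1)) : ℝ) ^ 2 * N := by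
          gcongr
          simpa using hBN
  have hlt14 : ‖cutoff (B : Set Y) (w p)‖ < 1 / 4 := by
    refine lt_of_pow_lt_pow_left₀ 2 (by norm_num) (hsq.trans_lt ?_)
    rw [div_pow, mul_pow, one_pow, div_mul_eq_mul_div, one_mul, div_lt_iff₀ (by positivity)]
    have hN0 : (0 : ℝ) ≤ N := N.cast_nonneg
    nlinarith
  have hfar := (hr s).norm_sub_cutoff_le y hB
  have hrest : ‖cutoff (B : Set Y) (w (deltaVec y - p))‖ < 1 / 4 := by
    refine (norm_cutoff_le _ _).trans_lt ?_
    rwa [hw, norm_map_signOp_apply]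
  have hdec : w (deltaVec y) = (w (deltaVec y) - cutoff (B : Set Y) (w (deltaVec y))) +
      (cutoff (B : Set Y) (w p) + cutoff (B : Set Y) (w (deltaVec y - p))) := by
    rw [map_sub, map_sub]
    abel
  have hone : ‖w (deltaVec y)‖ = 1 := by rw [hw, norm_map_signOp_apply, norm_deltaVec]
  -- The unit vector `w (deltaVec y)` has at most `1 / 2` outside `B`, and two pieces below `1 / 4`
  -- inside: a contradiction.
  have htri := norm_add₃_le (a := w (deltaVec y) - cutoff (B : Set Y) (w (deltaVec y)))
    (b := cutoff (B : Set Y) (w p)) (c := cutoff (B : Set Y) (w (deltaVec y - p)))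
  rw [add_assoc, ← hdec, hone] at htri
  linarith

/-- The frame vectors are uniformly concentrated on balls around points where they are large. -/
theorem exists_norm_sub_cutoff_le (h : IsImageFrame Φ ξ) {δ : ℝ} (hδ : 0 < δ) {η : ℝ}
    (hη : 0 < η) : ∃ r, ∀ x y, δ ≤ ‖ξ x y‖ → ∀ B : Finset Y,
      (B : Set Y) = Metric.closedBall y r → ‖ξ x - cutoff (B : Set Y) (ξ x)‖ ≤ η := by
  -- Column `y` of the projection is `ξ x` scaled by a number of modulus at least `δ`, so decay `δ *
  -- η` becomes `η` after division.
  obtain ⟨r, hr⟩ := h.exists_columnDecay_matUnit (mul_pos hδ hη)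
  refine ⟨r, fun x y hxy B hB => ?_⟩
  have h1 := (hr x).norm_sub_cutoff_le y hB
  rw [h.apply_matUnit_deltaVec, map_smul, ← smul_sub, norm_smul, RCLike.norm_conj] at h1
  refine le_of_mul_le_mul_left (le_trans ?_ h1) hδ
  exact mul_le_mul_of_nonneg_right hxy (norm_nonneg _)

end IsImageFrame

/-! ### Transfer of the ghost property -/

theorem norm_inner_cutoff_le {Y : Type*} (b : BoundedOp Y) {v w : EllTwo Y} (hv : ‖v‖ ≤ 1) (hw : ‖w‖ ≤ 1)
    (B C : Finset Y) {ε : ℝ} (hε : ∀ y ∈ B, ∀ z ∈ C, ‖matEntry b y z‖ ≤ ε) :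
    ‖(inner ℂ (cutoff (B : Set Y) v) (b (cutoff (C : Set Y) w)) : ℂ)‖ ≤ B.card * (C.card * ε) := by
  have hcoord {u : EllTwo Y} (hu : ‖u‖ ≤ 1) (y : Y) : ‖u y‖ ≤ 1 :=
    (lp.norm_apply_le_norm (by norm_num) u y).trans hu
  rw [cutoff_finset_eq_sum, cutoff_finset_eq_sum, map_sum, sum_inner, ← nsmul_eq_mul,
    ← nsmul_eq_mul]
  refine (norm_sum_le _ _).trans (Finset.sum_le_card_nsmul _ _ _ fun y hy => ?_)
  rw [inner_sum]
  refine (norm_sum_le _ _).trans (Finset.sum_le_card_nsmul _ _ _ fun z hz => ?_)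
  rw [map_smul, inner_smul_left, inner_smul_right, ← matEntry_eq_inner, norm_mul, norm_mul,
    RCLike.norm_conj]
  calc ‖v y‖ * (‖w z‖ * ‖matEntry b y z‖) ≤ 1 * (1 * ‖matEntry b y z‖) := by
        gcongr
        · exact hcoord hv y
        · exact hcoord hw z
    _ ≤ ε := by simpa using hε y hy z hz

theorem isGhost_iff_exists_finite {X : Type*} {a : BoundedOp X} : IsGhost a ↔ ∀ ε > 0, ∃ F : Set X, F.Finite ∧
    ∀ x ∉ F, ∀ x' ∉ F, ‖matEntry a x x'‖ ≤ ε := by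
  constructor
  · intro h ε hε
    have h1 := h (Metric.closedBall_mem_nhds 0 hε)
    obtain ⟨s, hs, t, ht, hst⟩ := mem_prod_iff.1 (mem_map.1 h1)
    refine ⟨sᶜ ∪ tᶜ, Set.Finite.union hs ht, fun x hx x' hx' => ?_⟩
    simp only [Set.mem_union, Set.mem_compl_iff, not_or, not_not] at hx hx'
    simpa using hst (Set.mk_mem_prod hx.1 hx'.2)
  · intro h
    refine Metric.nhds_basis_closedBall.tendsto_right_iff.2 fun ε hε => ?_
    obtain ⟨F, hF, hle⟩ := h ε hε
    have hFc : Fᶜ ∈ (cofinite : Filter X) := hF.compl_mem_cofinite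
    filter_upwards [prod_mem_prod hFc hFc] with p hp
    simpa using hle p.1 hp.1 p.2 hp.2

theorem isGhost_of_isGhost_map (hX : UniformlyLocallyFinite X) (hY : UniformlyLocallyFinite Y)
    (Φ : uniformRoeAlgebra X ≃⋆ₐ[ℂ] uniformRoeAlgebra Y) (a : uniformRoeAlgebra X)
    (ha : IsGhost (Φ a : BoundedOp Y)) : IsGhost (a : BoundedOp X) := by
  classical
  obtain ⟨ξ, hξ⟩ := exists_isImageFrame Φ
  obtain ⟨ζ, hζ⟩ := exists_isImageFrame Φ.symm
  obtain ⟨δ, hδ, hlow⟩ := hζ.exists_le_norm_apply hX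
  choose g hg using hlow
  -- The lower bound for the frame of `Φ.symm` becomes one for `ξ x` at `g x`.
  simp_rw [← hξ.norm_apply_eq_symm hζ] at hg
  rw [isGhost_iff_exists_finite] at ha ⊢
  intro ε hε
  set b : BoundedOp Y := (Φ a : BoundedOp Y)
  have hη : 0 < ε / (4 * (‖b‖ + 1)) := by positivity
  obtain ⟨r, hr⟩ := hξ.exists_norm_sub_cutoff_le hδ hη
  obtain ⟨N, hN⟩ := hY.exists_finset_closedBall r
  choose B hB hBN using hN
  -- At most `(N + 1) ^ 2` entries contribute, for a total of `ε / 2`; the two localization errors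
  -- take `ε / 4` each.
  obtain ⟨G, hG, hGle⟩ := ha (ε / (2 * (N + 1) ^ 2)) (by positivity)
  -- If the ball about `g x` meets `G`, then `g x` lies in `B y` for some `y ∈ G`, so `x` is in this
  -- union, which is finite by `finite_setOf_le_norm`.
  refine ⟨⋃ y ∈ G, ⋃ z ∈ B y, {x | δ ≤ ‖ξ x z‖}, hG.biUnion fun y _ =>
    (B y).finite_toSet.biUnion fun z _ => hξ.finite_setOf_le_norm hδ z, fun x hx x' hx' => ?_⟩
  have hout {x : X} (hx : x ∉ ⋃ y ∈ G, ⋃ z ∈ B y, {x | δ ≤ ‖ξ x z‖}) {y : Y} (hy : y ∈ B (g x)) :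
      y ∉ G := by
    intro hyG
    refine hx (Set.mem_biUnion hyG (Set.mem_biUnion (x := g x) ?_ (hg x)))
    have h1 : y ∈ (B (g x) : Set Y) := hy
    change g x ∈ (B y : Set Y)
    rw [hB] at h1 ⊢
    exact Metric.mem_closedBall_comm.1 h1
  set v := cutoff (B (g x) : Set Y) (ξ x) with hv
  set v' := cutoff (B (g x') : Set Y) (ξ x') with hv'
  have hvx : ‖ξ x - v‖ ≤ ε / (4 * (‖b‖ + 1)) := hr x (g x) (hg x) _ (hB _)
  have hvx' : ‖ξ x' - v'‖ ≤ ε / (4 * (‖b‖ + 1)) := hr x' (g x') (hg x') _ (hB _)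
  have hvn : ‖v‖ ≤ 1 := (norm_cutoff_le _ _).trans (hξ x).1.le
  have hmain : ‖(inner ℂ v (b v') : ℂ)‖ ≤ ε / 2 := by
    refine (norm_inner_cutoff_le b (hξ x).1.le (hξ x').1.le _ _
      fun y hy z hz => hGle y (hout hx hy) z (hout hx' hz)).trans ?_
    have hN1 : ((B (g x)).card : ℝ) ≤ N + 1 :=
      (Nat.cast_le.2 (hBN _)).trans (by linarith)
    have hN2 : ((B (g x')).card : ℝ) ≤ N + 1 :=
      (Nat.cast_le.2 (hBN _)).trans (by linarith)
    calc ((B (g x)).card : ℝ) * ((B (g x')).card * (ε / (2 * (N + 1) ^ 2)))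
        ≤ (N + 1) * ((N + 1) * (ε / (2 * (N + 1) ^ 2))) := by gcongr
      _ = ε / 2 := by field_simp
  have hop (u u' : EllTwo Y) : ‖(inner ℂ u (b u') : ℂ)‖ ≤ ‖u‖ * (‖b‖ * ‖u'‖) :=
    (norm_inner_le_norm _ _).trans (mul_le_mul_of_nonneg_left (b.le_opNorm _) (norm_nonneg _))
  have hquarter : ‖b‖ * (ε / (4 * (‖b‖ + 1))) ≤ ε / 4 := by
    rw [show ‖b‖ * (ε / (4 * (‖b‖ + 1))) = ε / 4 * (‖b‖ / (‖b‖ + 1)) by field_simp]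
    exact mul_le_of_le_one_right (by positivity)
      ((div_le_one (by positivity)).2 (by linarith))
  have h1 : ‖(inner ℂ (ξ x - v) (b (ξ x')) : ℂ)‖ ≤ ε / 4 := by
    refine (hop _ _).trans (le_trans ?_ hquarter)
    rw [(hξ x').1, mul_one, mul_comm]
    exact mul_le_mul_of_nonneg_left hvx (norm_nonneg _)
  have h2 : ‖(inner ℂ v (b (ξ x' - v')) : ℂ)‖ ≤ ε / 4 := by
    refine (hop _ _).trans (le_trans ?_ hquarter)
    refine (mul_le_of_le_one_left (by positivity) hvn).trans ?_
    exact mul_le_mul_of_nonneg_left hvx' (norm_nonneg _)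
  have hdec : (inner ℂ (ξ x) (b (ξ x')) : ℂ) =
      inner ℂ (ξ x - v) (b (ξ x')) + inner ℂ v (b (ξ x' - v')) + inner ℂ v (b v') := by
    rw [inner_sub_left, map_sub, inner_sub_right]
    ring
  rw [hξ.norm_matEntry, hdec]
  refine norm_add₃_le.trans ?_
  linarith

end Isomorphism

/-- Every `*`-isomorphism between uniform Roe algebras of uniformly locally finite metric spaces
maps ghosts to ghosts and non-ghosts to non-ghosts. -/
theorem theorem1p5 {X Y : Type*} [MetricSpace X] [MetricSpace Y]
    (hX : UniformlyLocallyFinite X) (hY : UniformlyLocallyFinite Y)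
    (Φ : uniformRoeAlgebra X ≃⋆ₐ[ℂ] uniformRoeAlgebra Y) (a : uniformRoeAlgebra X) :
    IsGhost (a : BoundedOp X) ↔ IsGhost (Φ a : BoundedOp Y) := by
  refine ⟨fun h => isGhost_of_isGhost_map hY hX Φ.symm (Φ a) ?_, isGhost_of_isGhost_map hX hY Φ a⟩
  rwa [StarAlgEquiv.symm_apply_apply]
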